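/- Let $k$ be an algebraically closed field of characteristic $0$. For a polynomial $f\in k[x,y]$ and a point $P=(p_1,p_2)\in k^2$, let $m_P(f)$ (for $f\neq 0$) be the least degree of a nonzero term of $f(x+p_1,y+p_2)$. Say that $f$ and $g$ share a component through $P$ if some irreducible $q\in k[x,y]$ with $q(P)=0$ divides both $f$ and $g$. Blow up the plane at $P$, and identify the exceptional line with $\mathbb{P}^1(k)$, with homogeneous coordinates $(t_0:t_1)$, where $(x-p_1)t_1=(y-p_2)t_0$ on the blowup surface. Near a point $Q=(1:c)$ of the exceptional line use the chart coordinates $u=x-p_1$, $z=t_1/t_0$; there $Q$ is the point $(0,c)$ and the strict transform of $f$ is $f'(u,z)=f(p_1+u,\,p_2+uz)/u^{m_P(f)}$. Near the point $Q=(0:1)$ use the coordinates $w=t_0/t_1$, $v=y-p_2$; there $Q$ is the point $(0,0)$ and the strict transform is $f'(w,v)=f(p_1+wv,\,p_2+v)/v^{m_P(f)}$. The first order infinitely near points at $P$ common to $f$ and $g$ are the points $Q$ of the exceptional line with $f'(Q)=g'(Q)=0$. The blowup intersection number $\mathcal{B}_P(f,g)\in\mathbb{N}\cup\{\infty\}$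 is defined recursively by $$\mathcal{B}_P(f,g)=\begin{cases}\infty,&\text{if } f,g\text{ share a component through }P,\\ 0,&\text{if } f(P)\neq 0\text{ or } g(P)\neq 0,\\ m_P(f)\,m_P(g)+\sum_Q\mathcal{B}_Q(f',g'),&\text{otherwise,}\end{cases}$$ where $Q$ runs through the (finitely many) first order infinitely near points at $P$ common to $f$ and $g$; precisely, $\mathcal{B}_P(f,g)$ is the supremum over $n$ of the values obtained by cutting this recursion off, with value $0$, after $n$ steps. **Proposition 3.8.** Let $f,g\in k[x,y]$ be non-constant polynomials and let $P\in k^2$ be a point such that $f$ and $g$ share no component through $P$. Then $$\mathcal{B}_P(f,\,g+hf)=\mathcal{B}_P(f,g)\qquad\text{for every } h\in k[x,y].$$ -/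

import Mathlib

noncomputable section

open MvPolynomial

namespace PlaneCurve

variable {k : Type*} [Field k]

/-- The Taylor expansion of `f` at `P`: the polynomial `f(x + p₁, y + p₂)`, whose coefficients are
those of `f` written as a polynomial in `x - p₁` and `y - p₂`. -/
def taylorAt (P : Fin 2 → k) (f : MvPolynomial (Fin 2) k) : MvPolynomial (Fin 2) k :=
  aeval (fun i => X i + C (P i)) f

/-- The multiplicity `m_P(f)`: the least degree of a term with nonzero coefficient in the Taylor
expansion of `f` at `P` (meaningful for `f ≠ 0`). -/
def mult (P : Fin 2 → k) (f : MvPolynomial (Fin 2) k) : ℕ :=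
  sInf {n | ∃ s : Fin 2 →₀ ℕ, coeff s (taylorAt P f) ≠ 0 ∧ s.degree = n}

/-- The curves of `f` and `g` share a component passing through `P`. -/
def ShareComponentThrough (P : Fin 2 → k) (f g : MvPolynomial (Fin 2) k) : Prop :=
  ∃ q : MvPolynomial (Fin 2) k, Irreducible q ∧ q ∣ f ∧ q ∣ g ∧ eval P q = 0

/-- The strict transform of the curve of `f` under the blowup of the plane at `P`, in an affine
chart of the blowup surface `(x - p₁) t₁ = (y - p₂) t₀`. The exceptional line is the projective
line, with points `(t₀ : t₁) = (1 : c)`, written `c`, and `(0 : 1)`, written `∞`; the argument of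
type `OnePoint k` is a point of the exceptional line and selects a chart containing it.
* For `c : k` the chart is `t₀ ≠ 0`, with coordinates `u = x - p₁` and `z = t₁ / t₀`; the exceptional
  line is `u = 0`, and the strict transform is `f(p₁ + u, p₂ + u z) / u ^ m_P(f)`.
* For `∞` the chart is `t₁ ≠ 0`, with coordinates `w = t₀ / t₁` and `v = y - p₂`; the exceptional
  line is `v = 0`, and the strict transform is `f(p₁ + w v, p₂ + v) / v ^ m_P(f)`.
Both divisions are exact. -/
def strictTransform (P : Fin 2 → k) (f : MvPolynomial (Fin 2) k) :
    OnePoint k → MvPolynomial (Fin 2) k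
  | OnePoint.some _ =>
      divMonomial (aeval ![X 0, X 0 * X 1] (taylorAt P f)) (Finsupp.single 0 (mult P f))
  | OnePoint.infty =>
      divMonomial (aeval ![X 0 * X 1, X 1] (taylorAt P f)) (Finsupp.single 1 (mult P f))

/-- The coordinates of a point of the exceptional line in the chart used by `strictTransform`. -/
def excPoint : OnePoint k → Fin 2 → k
  | OnePoint.some c => ![0, c]
  | OnePoint.infty => ![0, 0]

/-- The first order infinitely near points at `P` common to the curves of `f` and `g`: the points of
the exceptional line lying on both strict transforms. -/
def commonNear (P : Fin 2 → k) (f g : MvPolynomial (Fin 2) k) : Set (OnePoint k) :=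
  {Q | eval (excPoint Q) (strictTransform P f Q) = 0 ∧
    eval (excPoint Q) (strictTransform P g Q) = 0}

open Classical in
/-- The recursion that defines the blowup intersection number, cut off after `n` steps. -/
def blowupNumberAux : ℕ → (Fin 2 → k) → MvPolynomial (Fin 2) k → MvPolynomial (Fin 2) k → ℕ∞
  | 0, _, _, _ => 0
  | n + 1, P, f, g =>
    if ShareComponentThrough P f g then ⊤
    else if ¬ (eval P f = 0 ∧ eval P g = 0) then 0
    else (mult P f : ℕ∞) * (mult P g : ℕ∞) +
      ∑ᶠ Q ∈ commonNear P f g,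
        blowupNumberAux n (excPoint Q) (strictTransform P f Q) (strictTransform P g Q)

/-- The blowup intersection number `𝓑_P(f, g)`. The cut-off values increase with `n`, and they are
eventually constant when the recursion terminates; `blowupNumber_eq` below shows that the full
recursion holds. -/
def blowupNumber (P : Fin 2 → k) (f g : MvPolynomial (Fin 2) k) : ℕ∞ :=
  ⨆ n, blowupNumberAux n P f g

/-- Coefficients of `p(u, u z)`. -/
theorem coeff_pull_zero (p : MvPolynomial (Fin 2) k) (t : Fin 2 →₀ ℕ) :
    coeff t (aeval ![X 0, X 0 * X 1] p : MvPolynomial (Fin 2) k) =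
      if t 1 ≤ t 0 then coeff (Finsupp.single 0 (t 0 - t 1) + Finsupp.single 1 (t 1)) p else 0 := by
  induction p using MvPolynomial.induction_on' with
  | monomial s a =>
    have h : (aeval ![X 0, X 0 * X 1] (monomial s a) : MvPolynomial (Fin 2) k) =
        monomial (Finsupp.single 0 (s 0 + s 1) + Finsupp.single 1 (s 1)) a := by
      rw [aeval_monomial, Finsupp.prod_fintype _ _ (by simp)]
      simp only [Fin.prod_univ_two, Matrix.cons_val_zero, Matrix.cons_val_one, monomial_eq,
        Finsupp.prod_fintype, pow_zero, implies_true, Finsupp.add_apply, algebraMap_eq]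
      simp only [Finsupp.single_apply, Fin.isValue, one_ne_zero, zero_ne_one, if_true, if_false,
        add_zero, zero_add]
      ring
    rw [h, coeff_monomial, coeff_monomial]
    simp only [Finsupp.ext_iff, Fin.forall_fin_two]
    simp
    grind
  | add p q hp hq => rw [map_add, coeff_add, hp, hq]; split_ifs <;> simp

/-- Coefficients of `p(w v, v)`. -/
theorem coeff_pull_one (p : MvPolynomial (Fin 2) k) (t : Fin 2 →₀ ℕ) :
    coeff t (aeval ![X 0 * X 1, X 1] p : MvPolynomial (Fin 2) k) =
      if t 0 ≤ t 1 then coeff (Finsupp.single 0 (t 0) + Finsupp.single 1 (t 1 - t 0)) p else 0 := by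
  induction p using MvPolynomial.induction_on' with
  | monomial s a =>
    have h : (aeval ![X 0 * X 1, X 1] (monomial s a) : MvPolynomial (Fin 2) k) =
        monomial (Finsupp.single 0 (s 0) + Finsupp.single 1 (s 0 + s 1)) a := by
      rw [aeval_monomial, Finsupp.prod_fintype _ _ (by simp)]
      simp only [Fin.prod_univ_two, Matrix.cons_val_zero, Matrix.cons_val_one, monomial_eq,
        Finsupp.prod_fintype, pow_zero, implies_true, Finsupp.add_apply, algebraMap_eq]
      simp only [Finsupp.single_apply, Fin.isValue, one_ne_zero, zero_ne_one, if_true, if_false,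
        add_zero, zero_add]
      ring
    rw [h, coeff_monomial, coeff_monomial]
    simp only [Finsupp.ext_iff, Fin.forall_fin_two]
    simp
    grind
  | add p q hp hq => rw [map_add, coeff_add, hp, hq]; split_ifs <;> simp

theorem mult_le (P : Fin 2 → k) (f : MvPolynomial (Fin 2) k) (s : Fin 2 →₀ ℕ)
    (hs : coeff s (taylorAt P f) ≠ 0) : mult P f ≤ s 0 + s 1 := by
  refine Nat.sInf_le ⟨s, hs, ?_⟩
  simp [Finsupp.degree_eq_sum, Fin.sum_univ_two]

/-- The division in the chart `t₀ ≠ 0` is exact. -/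
theorem strictTransform_some (P : Fin 2 → k) (f : MvPolynomial (Fin 2) k) (c : k) :
    X 0 ^ mult P f * strictTransform P f (OnePoint.some c) =
      aeval ![X 0, X 0 * X 1] (taylorAt P f) := by
  have h := divMonomial_add_modMonomial
    (aeval ![X 0, X 0 * X 1] (taylorAt P f) : MvPolynomial (Fin 2) k)
    (Finsupp.single 0 (mult P f))
  rw [X_pow_eq_monomial]
  refine Eq.trans ?_ h
  refine left_eq_add.2 ?_
  ext t
  by_cases ht : Finsupp.single 0 (mult P f) ≤ t
  · rw [coeff_modMonomial_of_le _ ht, coeff_zero]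
  · rw [coeff_modMonomial_of_not_le _ ht, coeff_pull_zero, coeff_zero]
    split_ifs with h1
    · by_contra h2
      have := mult_le P f _ h2
      simp at this ht
      omega
    · rfl

/-- The division in the chart `t₁ ≠ 0` is exact. -/
theorem strictTransform_infty (P : Fin 2 → k) (f : MvPolynomial (Fin 2) k) :
    X 1 ^ mult P f * strictTransform P f OnePoint.infty =
      aeval ![X 0 * X 1, X 1] (taylorAt P f) := by
  have h := divMonomial_add_modMonomial
    (aeval ![X 0 * X 1, X 1] (taylorAt P f) : MvPolynomial (Fin 2) k)
    (Finsupp.single 1 (mult P f))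
  rw [X_pow_eq_monomial]
  refine Eq.trans ?_ h
  refine left_eq_add.2 ?_
  ext t
  by_cases ht : Finsupp.single 1 (mult P f) ≤ t
  · rw [coeff_modMonomial_of_le _ ht, coeff_zero]
  · rw [coeff_modMonomial_of_not_le _ ht, coeff_pull_one, coeff_zero]
    split_ifs with h1
    · by_contra h2
      have := mult_le P f _ h2
      simp at this ht
      omega
    · rfl

theorem taylorAt_ne_zero (P : Fin 2 → k) {f : MvPolynomial (Fin 2) k} (hf : f ≠ 0) :
    taylorAt P f ≠ 0 := by
  intro h
  apply hf
  have h2 : aeval (fun i => X i - C (P i)) (taylorAt P f) = f := by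
    unfold taylorAt
    rw [← AlgHom.comp_apply]
    conv_rhs => rw [← AlgHom.id_apply (R := k) f]
    congr 1
    ext i
    simp
  rw [← h2, h, map_zero]

theorem coeff_restrict (p : MvPolynomial (Fin 2) k) (j : ℕ) :
    (aeval ![0, Polynomial.X] p : Polynomial k).coeff j = coeff (Finsupp.single 1 j) p := by
  induction p using MvPolynomial.induction_on' with
  | monomial s a =>
    rw [aeval_monomial, Finsupp.prod_fintype _ _ (by simp), coeff_monomial]
    simp only [Fin.prod_univ_two, Matrix.cons_val_zero, Matrix.cons_val_one, Finsupp.ext_iff,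
      Fin.forall_fin_two, Polynomial.algebraMap_eq]
    rcases Nat.eq_zero_or_pos (s 0) with h | h
    · simp [h, Polynomial.coeff_X_pow, eq_comm]
    · simp [h.ne']
  | add p q hp hq => rw [map_add, Polynomial.coeff_add, hp, hq, coeff_add]

theorem commonNear_finite (P : Fin 2 → k) {f : MvPolynomial (Fin 2) k} (hf : f ≠ 0)
    (g : MvPolynomial (Fin 2) k) : (commonNear P f g).Finite := by
  classical
  set q : Polynomial k := aeval ![0, Polynomial.X] (strictTransform P f (OnePoint.some 0)) with hq
  have hq0 : q ≠ 0 := by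
    obtain ⟨s, hs⟩ := ne_zero_iff.1 (taylorAt_ne_zero P hf)
    obtain ⟨s, hs, hm⟩ : mult P f ∈
        {n | ∃ s : Fin 2 →₀ ℕ, coeff s (taylorAt P f) ≠ 0 ∧ s.degree = n} :=
      Nat.sInf_mem ⟨_, s, hs, rfl⟩
    rw [Finsupp.degree_eq_sum, Fin.sum_univ_two] at hm
    intro h
    apply hs
    have h1 : q.coeff (s 1) = 0 := by rw [h, Polynomial.coeff_zero]
    rw [hq, coeff_restrict, strictTransform.eq_def] at h1
    dsimp only at h1
    rw [coeff_divMonomial, coeff_pull_zero] at h1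
    rw [if_pos (by simp; omega)] at h1
    convert h1
    ext i
    fin_cases i
    · simp; omega
    · simp
  have key : ∀ c : k, eval ![0, c] (strictTransform P f (OnePoint.some c)) = q.eval c := by
    intro c
    have h2 : (Polynomial.aeval c).comp (aeval (R := k) ![0, Polynomial.X]) =
        aeval (R := k) ![0, c] := by
      ext i
      fin_cases i <;> simp
    have h3 := DFunLike.congr_fun h2 (strictTransform P f (OnePoint.some 0))
    rw [AlgHom.comp_apply, ← hq] at h3
    rw [← Polynomial.coe_aeval_eq_eval, h3]
    rfl
  refine Set.Finite.subset (((q.roots.toFinset.finite_toSet).image OnePoint.some).union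
    (Set.finite_singleton OnePoint.infty)) ?_
  rintro (_ | c) ⟨hQ, -⟩
  · exact Or.inr rfl
  · refine Or.inl ⟨c, ?_, rfl⟩
    have : q.eval c = 0 := by rw [← key]; exact hQ
    simpa [hq0] using this

theorem ne_zero_of_not_share {P : Fin 2 → k} {f g : MvPolynomial (Fin 2) k}
    (h : ¬ ShareComponentThrough P f g) (hg : eval P g = 0) : f ≠ 0 := by
  rintro rfl
  apply h
  by_cases h0 : g = 0
  · subst h0
    refine ⟨X 0 - C (P 0), ?_, dvd_zero _, dvd_zero _, by simp⟩
    have h1 := irreducible_mul_X_add (1 : MvPolynomial (Fin 2) k) (-C (P 0)) 0 one_ne_zero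
      (by simp) (by simp [vars_neg]) isRelPrime_one_left
    rwa [one_mul, ← sub_eq_add_neg] at h1
  · have hu : ¬ IsUnit g := fun hu => by
      have := hu.map (eval P)
      rw [hg] at this
      exact not_isUnit_zero this
    obtain ⟨w, hw, hwg⟩ : ∃ q, Irreducible q ∧ q ∣ g ∧ eval P q = 0 := by
      clear h
      induction g using WfDvdMonoid.induction_on_irreducible with
      | zero => exact absurd rfl h0
      | unit u hu' => exact absurd hu' hu
      | mul a i ha hi ih =>
        rw [map_mul, mul_eq_zero] at hg
        rcases hg with hg | hg
        · exact ⟨i, hi, dvd_mul_right _ _, hg⟩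
        · have hu2 : ¬ IsUnit a := fun hu => by
            have := hu.map (eval P)
            rw [hg] at this
            exact not_isUnit_zero this
          obtain ⟨q, h1, h2, h3⟩ := ih hg ha hu2
          exact ⟨q, h1, h2.mul_left _, h3⟩
    exact ⟨w, hw, dvd_zero _, hwg.1, hwg.2⟩

theorem blowupNumberAux_mono (n : ℕ) (P : Fin 2 → k) (f g : MvPolynomial (Fin 2) k) :
    blowupNumberAux n P f g ≤ blowupNumberAux (n + 1) P f g := by
  induction n generalizing P f g with
  | zero => simp [blowupNumberAux]
  | succ n ih =>
    rw [blowupNumberAux, blowupNumberAux]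
    split_ifs with h1 h2
    · exact le_rfl
    · have hfin := commonNear_finite P (ne_zero_of_not_share h1 h2.2) g
      rw [finsum_mem_eq_finite_toFinset_sum _ hfin, finsum_mem_eq_finite_toFinset_sum _ hfin]
      gcongr
      exact ih _ _ _
    · exact le_rfl

open Classical in
/-- The recursion that defines `𝓑_P(f, g)`. -/
theorem blowupNumber_eq (P : Fin 2 → k) (f g : MvPolynomial (Fin 2) k) :
    blowupNumber P f g =
      if ShareComponentThrough P f g then ⊤
      else if ¬ (eval P f = 0 ∧ eval P g = 0) then 0
      else (mult P f : ℕ∞) * (mult P g : ℕ∞) +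
        ∑ᶠ Q ∈ commonNear P f g,
          blowupNumber (excPoint Q) (strictTransform P f Q) (strictTransform P g Q) := by
  have hmono : ∀ (P : Fin 2 → k) (f g : MvPolynomial (Fin 2) k),
      Monotone fun n => blowupNumberAux n P f g :=
    fun P f g => monotone_nat_of_le_succ fun n => blowupNumberAux_mono n P f g
  have h0 : blowupNumber P f g = ⨆ n, blowupNumberAux (n + 1) P f g :=
    ((hmono P f g).iSup_nat_add 1).symm
  rw [h0]
  simp only [blowupNumberAux]
  split_ifs with h1 h2
  · simp
  · have hfin := commonNear_finite P (ne_zero_of_not_share h1 h2.2) g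
    simp only [finsum_mem_eq_finite_toFinset_sum _ hfin]
    rw [← ENat.add_iSup]
    congr 1
    generalize hfin.toFinset = S
    unfold blowupNumber
    symm
    apply ENat.sum_iSup_of_monotone
    exact fun Q => hmono _ _ _
  · simp

end PlaneCurve

end

noncomputable section

open MvPolynomial

namespace PlaneCurve

variable {k : Type*} [Field k]

/-! Write `m` for `mult P` and `e` for the equation of the exceptional line. Adding `h * f` to `g`
can change the multiplicity of `g`, so the strict transforms of `g` and `g + h * f` need not differ
by a multiple of the strict transform `f'`. The remedy is to divide both pullbacks by the same power
of `e`.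

Two facts make this harmless. The number is additive in its second argument (`blowupNumber_mul`),
because multiplicities add and strict transforms multiply. Over an algebraically closed field, `f'`
meets the exceptional line with total multiplicity `m f` (`sum_blowupNumber_exceptional`), since its
restriction there is the leading form of `f`. Hence the recursion may use any `n ≤ m g` in place of
`m g`, provided `g'` is replaced by `e ^ (m g - n) * g'` (`blowupNumber_eq_sum_of_le_mult`).

With `n` the smaller of the two multiplicities, the transforms so modified again differ by a
multiple of `f'` (`exists_strictTransform_add_mul`). When the value is finite, `m f * n > 0` makes
every term of the sum smaller than it, and induction on the value applies. -/

/-! ### Multiplicity and strict transform, uniformly in the chart -/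

/-- The pullback of functions along the blowup at `P`, in the chart selected by `Q`. -/
def pullback (P : Fin 2 → k) (Q : OnePoint k) :
    MvPolynomial (Fin 2) k →ₐ[k] MvPolynomial (Fin 2) k :=
  (aeval (match Q with
    | OnePoint.some _ => ![X 0, X 0 * X 1]
    | OnePoint.infty => ![X 0 * X 1, X 1] : Fin 2 → MvPolynomial (Fin 2) k)).comp (aeval fun i => X i + C (P i))

/-- The equation of the exceptional line in the chart selected by `Q`. -/
def exceptional : OnePoint k → MvPolynomial (Fin 2) k
  | OnePoint.some _ => X 0
  | OnePoint.infty => X 1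

/-- The restriction of functions to the exceptional line in the chart selected by `Q`. -/
def restrictExc (Q : OnePoint k) : MvPolynomial (Fin 2) k →ₐ[k] Polynomial k :=
  aeval (match Q with
    | OnePoint.some _ => ![0, Polynomial.X]
    | OnePoint.infty => ![Polynomial.X, 0])

/-- The affine coordinate of `Q` on the exceptional line. -/
def excCoord : OnePoint k → k
  | OnePoint.some c => c
  | OnePoint.infty => 0

theorem pullback_eq (P : Fin 2 → k) (Q : OnePoint k) (f : MvPolynomial (Fin 2) k) :
    pullback P Q f = exceptional Q ^ mult P f * strictTransform P f Q := by
  induction Q using OnePoint.rec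
  · exact (strictTransform_infty P f).symm
  · exact (strictTransform_some P f _).symm

theorem prime_exceptional (Q : OnePoint k) : Prime (exceptional Q) := by
  induction Q using OnePoint.rec <;> exact X_prime

theorem eval_excPoint (Q : OnePoint k) (p : MvPolynomial (Fin 2) k) :
    eval (excPoint Q) p = (restrictExc Q p).eval (excCoord Q) := by
  have h : (Polynomial.aeval (excCoord Q)).comp (restrictExc Q) =
      aeval (R := k) (excPoint Q) := by
    ext i
    induction Q using OnePoint.rec <;> fin_cases i <;> simp [restrictExc, excPoint, excCoord]
  have h' := DFunLike.congr_fun h p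
  rw [AlgHom.comp_apply, Polynomial.coe_aeval_eq_eval] at h'
  rw [h']
  rfl

theorem restrictExc_exceptional (Q : OnePoint k) : restrictExc Q (exceptional Q) = 0 := by
  induction Q using OnePoint.rec <;> simp [restrictExc, exceptional]

theorem coeff_restrictExc_infty (p : MvPolynomial (Fin 2) k) (j : ℕ) :
    (restrictExc OnePoint.infty p).coeff j = coeff (Finsupp.single 0 j) p := by
  unfold restrictExc
  dsimp only
  induction p using MvPolynomial.induction_on' with
  | monomial s a =>
    rw [aeval_monomial, Finsupp.prod_fintype _ _ (by simp), coeff_monomial]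
    simp only [Fin.prod_univ_two, Matrix.cons_val_zero, Matrix.cons_val_one, Finsupp.ext_iff,
      Fin.forall_fin_two, Polynomial.algebraMap_eq]
    rcases Nat.eq_zero_or_pos (s 1) with h | h
    · simp [h, Polynomial.coeff_X_pow, eq_comm]
    · simp [h.ne']
  | add p q hp hq => rw [map_add, Polynomial.coeff_add, hp, hq, coeff_add]

/-- On the exceptional line only the leading form of the Taylor expansion survives, dehomogenised.
The result does not depend on `c`. -/
theorem coeff_restrictExc_strictTransform_some (P : Fin 2 → k) (f : MvPolynomial (Fin 2) k)
    (c : k) (j : ℕ) :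
    (restrictExc (OnePoint.some c) (strictTransform P f (OnePoint.some c))).coeff j =
      if j ≤ mult P f then
        coeff (Finsupp.single 0 (mult P f - j) + Finsupp.single 1 j) (taylorAt P f) else 0 := by
  refine (coeff_restrict _ j).trans ?_
  rw [strictTransform.eq_def]
  dsimp only
  rw [coeff_divMonomial, coeff_pull_zero]
  simp

theorem coeff_restrictExc_strictTransform_infty (P : Fin 2 → k) (f : MvPolynomial (Fin 2) k)
    (j : ℕ) :
    (restrictExc OnePoint.infty (strictTransform P f OnePoint.infty)).coeff j =
      if j ≤ mult P f then
        coeff (Finsupp.single 0 j + Finsupp.single 1 (mult P f - j)) (taylorAt P f) else 0 := by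
  rw [coeff_restrictExc_infty, strictTransform.eq_def]
  dsimp only
  rw [coeff_divMonomial, coeff_pull_one]
  simp

theorem exists_coeff_mult (P : Fin 2 → k) {f : MvPolynomial (Fin 2) k} (hf : f ≠ 0) :
    ∃ i j, i + j = mult P f ∧
      coeff (Finsupp.single 0 i + Finsupp.single 1 j) (taylorAt P f) ≠ 0 := by
  obtain ⟨s, hs⟩ := ne_zero_iff.1 (taylorAt_ne_zero P hf)
  obtain ⟨s, hs, hm⟩ : mult P f ∈
      {n | ∃ s : Fin 2 →₀ ℕ, coeff s (taylorAt P f) ≠ 0 ∧ s.degree = n} :=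
    Nat.sInf_mem ⟨_, s, hs, rfl⟩
  rw [Finsupp.degree_eq_sum, Fin.sum_univ_two] at hm
  refine ⟨s 0, s 1, hm, ?_⟩
  convert hs
  ext i
  fin_cases i <;> simp

theorem restrictExc_strictTransform_ne_zero (P : Fin 2 → k) {f : MvPolynomial (Fin 2) k}
    (hf : f ≠ 0) (Q : OnePoint k) : restrictExc Q (strictTransform P f Q) ≠ 0 := by
  obtain ⟨i, j, hij, h⟩ := exists_coeff_mult P hf
  induction Q using OnePoint.rec with
  | infty =>
    intro h0
    have := coeff_restrictExc_strictTransform_infty P f i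
    rw [h0, if_pos (by omega), ← hij, Nat.add_sub_cancel_left, Polynomial.coeff_zero] at this
    exact h this.symm
  | coe c =>
    intro h0
    have := coeff_restrictExc_strictTransform_some P f c j
    rw [h0, if_pos (by omega), ← hij, Nat.add_sub_cancel_right, Polynomial.coeff_zero] at this
    exact h this.symm

theorem not_exceptional_dvd_strictTransform (P : Fin 2 → k) {f : MvPolynomial (Fin 2) k}
    (hf : f ≠ 0) (Q : OnePoint k) : ¬ exceptional Q ∣ strictTransform P f Q := by
  rintro ⟨w, hw⟩
  apply restrictExc_strictTransform_ne_zero P hf Q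
  rw [hw, map_mul, restrictExc_exceptional, zero_mul]

/-- The pullback determines the multiplicity and the strict transform. -/
theorem mult_and_strictTransform_eq {P : Fin 2 → k} {Q : OnePoint k}
    {f w : MvPolynomial (Fin 2) k} {n : ℕ} (hf : f ≠ 0)
    (h : pullback P Q f = exceptional Q ^ n * w) (hw : ¬ exceptional Q ∣ w) :
    mult P f = n ∧ strictTransform P f Q = w := by
  have he := prime_exceptional Q
  have hs := not_exceptional_dvd_strictTransform P hf Q
  rw [pullback_eq] at h
  have hm : mult P f = n := by
    -- `e` divides neither cofactor, so comparing powers of the prime `e` on both sides gives equal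
    -- exponents.
    apply le_antisymm
    · exact (pow_dvd_pow_iff he.ne_zero he.not_isUnit).1
        (he.pow_dvd_of_dvd_mul_right _ hw (h ▸ dvd_mul_right _ _))
    · exact (pow_dvd_pow_iff he.ne_zero he.not_isUnit).1
        (he.pow_dvd_of_dvd_mul_right _ hs (h ▸ dvd_mul_right _ _))
  refine ⟨hm, ?_⟩
  rw [hm] at h
  exact mul_left_cancel₀ (pow_ne_zero _ he.ne_zero) h

/-- Since `e` is prime, it does not divide the product of two strict transforms; uniqueness of the
factorisation of the pullback does the rest. -/
theorem mult_strictTransform_mul (P : Fin 2 → k) {f g : MvPolynomial (Fin 2) k} (hf : f ≠ 0)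
    (hg : g ≠ 0) (Q : OnePoint k) : mult P (f * g) = mult P f + mult P g ∧
      strictTransform P (f * g) Q = strictTransform P f Q * strictTransform P g Q := by
  apply mult_and_strictTransform_eq (mul_ne_zero hf hg)
  · rw [map_mul, pullback_eq, pullback_eq, pow_add]
    ring
  · intro h
    rcases (prime_exceptional Q).dvd_or_dvd h with h | h
    · exact not_exceptional_dvd_strictTransform P hf Q h
    · exact not_exceptional_dvd_strictTransform P hg Q h

theorem eval_pullback (P : Fin 2 → k) (Q : OnePoint k) (f : MvPolynomial (Fin 2) k) :
    eval (excPoint Q) (pullback P Q f) = eval P f := by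
  have h : (aeval (R := k) (excPoint Q)).comp (pullback P Q) = aeval (R := k) P := by
    ext i
    induction Q using OnePoint.rec <;> fin_cases i <;> simp [pullback, excPoint]
  exact DFunLike.congr_fun h f

theorem eval_exceptional (Q : OnePoint k) : eval (excPoint Q) (exceptional Q) = 0 := by
  rw [eval_excPoint, restrictExc_exceptional, Polynomial.eval_zero]

theorem mult_eq_zero_iff (P : Fin 2 → k) {f : MvPolynomial (Fin 2) k} (hf : f ≠ 0) :
    mult P f = 0 ↔ eval P f ≠ 0 := by
  constructor
  · intro h h0
    obtain ⟨i, j, hij, hc⟩ := exists_coeff_mult P hf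
    have hi : i = 0 := by omega
    have hj : j = 0 := by omega
    subst hi hj
    apply hc
    have h1 : (aeval (R := k) (0 : Fin 2 → k)) (taylorAt P f) = aeval (R := k) P f := by
      unfold taylorAt
      rw [← AlgHom.comp_apply]
      congr 1
      ext i
      simp
    rw [← aeval_eq_eval, ← h1] at h0
    simpa [aeval_zero, constantCoeff_eq] using h0
  · intro h
    by_contra h0
    apply h
    -- The choice of chart is immaterial: a positive power of `e` in the pullback makes it vanish at
    -- `excPoint`.
    rw [← eval_pullback P OnePoint.infty, pullback_eq, map_mul, map_pow, eval_exceptional,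
      zero_pow h0, zero_mul]

theorem eval_strictTransform_of_eval_ne_zero {P : Fin 2 → k} {f : MvPolynomial (Fin 2) k}
    (h : eval P f ≠ 0) (Q : OnePoint k) : eval (excPoint Q) (strictTransform P f Q) ≠ 0 := by
  have hf : f ≠ 0 := by rintro rfl; simp at h
  have := pullback_eq P Q f
  rw [(mult_eq_zero_iff P hf).2 h, pow_zero, one_mul] at this
  rwa [← this, eval_pullback]

/-! ### The uniform recursion and additivity -/

theorem not_share_of_eval_ne_zero_left {P : Fin 2 → k} {f : MvPolynomial (Fin 2) k}
    (g : MvPolynomial (Fin 2) k) (h : eval P f ≠ 0) : ¬ ShareComponentThrough P f g := by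
  rintro ⟨q, -, ⟨w, rfl⟩, -, h0⟩
  simp [h0] at h

theorem ShareComponentThrough.symm {P : Fin 2 → k} {f g : MvPolynomial (Fin 2) k}
    (h : ShareComponentThrough P f g) : ShareComponentThrough P g f := by
  obtain ⟨q, h1, h2, h3, h4⟩ := h
  exact ⟨q, h1, h3, h2, h4⟩

theorem shareComponentThrough_mul_iff {P : Fin 2 → k} {f g₁ g₂ : MvPolynomial (Fin 2) k} :
    ShareComponentThrough P f (g₁ * g₂) ↔
      ShareComponentThrough P f g₁ ∨ ShareComponentThrough P f g₂ := by
  constructor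
  · rintro ⟨q, h1, h2, h3, h4⟩
    rcases h1.prime.dvd_or_dvd h3 with h | h
    · exact Or.inl ⟨q, h1, h2, h, h4⟩
    · exact Or.inr ⟨q, h1, h2, h, h4⟩
  · rintro (⟨q, h1, h2, h3, h4⟩ | ⟨q, h1, h2, h3, h4⟩)
    · exact ⟨q, h1, h2, h3.mul_right _, h4⟩
    · exact ⟨q, h1, h2, h3.mul_left _, h4⟩

theorem ShareComponentThrough.add_mul {P : Fin 2 → k} {f g : MvPolynomial (Fin 2) k}
    (hs : ShareComponentThrough P f g) (h : MvPolynomial (Fin 2) k) :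
    ShareComponentThrough P f (g + h * f) := by
  obtain ⟨q, h1, h2, h3, h4⟩ := hs
  exact ⟨q, h1, h2, dvd_add h3 (h2.mul_left h), h4⟩

theorem blowupNumberAux_eq_zero {n : ℕ} {P : Fin 2 → k} {f g : MvPolynomial (Fin 2) k}
    (h : ¬ (eval P f = 0 ∧ eval P g = 0)) : blowupNumberAux n P f g = 0 := by
  cases n with
  | zero => rfl
  | succ n =>
    rw [blowupNumberAux, if_neg, if_pos h]
    intro hs
    by_cases hf : eval P f = 0
    · exact not_share_of_eval_ne_zero_left f (fun hg => h ⟨hf, hg⟩) hs.symm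
    · exact not_share_of_eval_ne_zero_left g hf hs

theorem blowupNumber_eq_zero {P : Fin 2 → k} {f g : MvPolynomial (Fin 2) k}
    (h : ¬ (eval P f = 0 ∧ eval P g = 0)) : blowupNumber P f g = 0 := by
  simp [blowupNumber, blowupNumberAux_eq_zero h]

theorem blowupNumber_eq_top {P : Fin 2 → k} {f g : MvPolynomial (Fin 2) k}
    (h : ShareComponentThrough P f g) : blowupNumber P f g = ⊤ := by
  rw [blowupNumber_eq, if_pos h]

open Classical in
/-- A finite set of points of the exceptional line that contains `∞` and all the points lying on
the strict transform of `f`. -/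
def nearPoints (P : Fin 2 → k) (f : MvPolynomial (Fin 2) k) : Finset (OnePoint k) :=
  insert OnePoint.infty
    ((restrictExc (OnePoint.some 0)
      (strictTransform P f (OnePoint.some 0))).roots.toFinset.map
        ⟨OnePoint.some, Option.some_injective k⟩)

theorem mem_nearPoints {P : Fin 2 → k} {f : MvPolynomial (Fin 2) k} (hf : f ≠ 0) {Q : OnePoint k}
    (hQ : eval (excPoint Q) (strictTransform P f Q) = 0) : Q ∈ nearPoints P f := by
  classical
  unfold nearPoints
  induction Q using OnePoint.rec
  · exact Finset.mem_insert_self _ _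
  · refine Finset.mem_insert_of_mem (Finset.mem_map.2 ⟨_, ?_, rfl⟩)
    rw [Multiset.mem_toFinset, Polynomial.mem_roots (restrictExc_strictTransform_ne_zero P hf _)]
    rw [eval_excPoint] at hQ
    exact hQ

/-- The index set `nearPoints P f` is independent of `g`, which later allows the recursions for `g`
and `g + h * f` to be compared term by term. -/
theorem finsum_commonNear_eq_sum {P : Fin 2 → k} {f g : MvPolynomial (Fin 2) k} (hf : f ≠ 0)
    (φ : OnePoint k → ℕ∞) (hφ : ∀ Q, Q ∉ commonNear P f g → φ Q = 0) :
    ∑ᶠ Q ∈ commonNear P f g, φ Q = ∑ Q ∈ nearPoints P f, φ Q := by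
  rw [finsum_mem_def]
  have h : (commonNear P f g).indicator φ = φ := by
    rw [Set.indicator_eq_self]
    intro Q hQ
    by_contra h
    exact hQ (hφ Q h)
  rw [h]
  apply finsum_eq_sum_of_support_subset
  intro Q hQ
  by_contra h
  exact hQ (hφ Q fun h' => h (mem_nearPoints hf h'.1))

/-- The clause with value `0` needs no separate treatment: if a curve misses `P`, its multiplicity
is `0` and its strict transform does not vanish at any `excPoint Q`. -/
theorem blowupNumberAux_succ {P : Fin 2 → k} {f g : MvPolynomial (Fin 2) k} (hf : f ≠ 0)
    (hg : g ≠ 0) (hs : ¬ ShareComponentThrough P f g) (n : ℕ) :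
    blowupNumberAux (n + 1) P f g = (mult P f : ℕ∞) * (mult P g : ℕ∞) +
      ∑ Q ∈ nearPoints P f,
        blowupNumberAux n (excPoint Q) (strictTransform P f Q) (strictTransform P g Q) := by
  by_cases h : eval P f = 0 ∧ eval P g = 0
  · rw [blowupNumberAux, if_neg hs, if_neg (not_not.2 h), finsum_commonNear_eq_sum hf]
    exact fun Q hQ => blowupNumberAux_eq_zero hQ
  · rw [blowupNumberAux_eq_zero h, Finset.sum_eq_zero, add_zero]
    · rw [not_and_or, ← ne_eq, ← ne_eq, ← mult_eq_zero_iff P hf, ← mult_eq_zero_iff P hg] at h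
      rcases h with h | h <;> simp [h]
    · intro Q _
      apply blowupNumberAux_eq_zero
      rintro ⟨h1, h2⟩
      apply h
      constructor
      · by_contra h'
        exact eval_strictTransform_of_eval_ne_zero h' Q h1
      · by_contra h'
        exact eval_strictTransform_of_eval_ne_zero h' Q h2

theorem blowupNumberAux_monotone (P : Fin 2 → k) (f g : MvPolynomial (Fin 2) k) :
    Monotone fun n => blowupNumberAux n P f g :=
  monotone_nat_of_le_succ fun n => blowupNumberAux_mono n P f g

/-- The recursion for `𝓑_P(f, g)`, with the sum over all points near the curve of `f`. -/
theorem blowupNumber_eq_sum {P : Fin 2 → k} {f g : MvPolynomial (Fin 2) k} (hf : f ≠ 0)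
    (hg : g ≠ 0) (hs : ¬ ShareComponentThrough P f g) :
    blowupNumber P f g = (mult P f : ℕ∞) * (mult P g : ℕ∞) +
      ∑ Q ∈ nearPoints P f,
        blowupNumber (excPoint Q) (strictTransform P f Q) (strictTransform P g Q) := by
  have h0 : blowupNumber P f g = ⨆ n, blowupNumberAux (n + 1) P f g :=
    ((blowupNumberAux_monotone P f g).iSup_nat_add 1).symm
  rw [h0]
  simp only [blowupNumberAux_succ hf hg hs]
  rw [← ENat.add_iSup]
  congr 1
  unfold blowupNumber
  symm
  apply ENat.sum_iSup_of_monotone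
  exact fun Q => blowupNumberAux_monotone _ _ _

/-- Additivity already holds at each cut-off: the index set depends on `f` alone, multiplicities
add, and strict transforms multiply. A shared component gives `⊤` on both sides. -/
theorem blowupNumberAux_mul (n : ℕ) (P : Fin 2 → k) (f g₁ g₂ : MvPolynomial (Fin 2) k) :
    blowupNumberAux n P f (g₁ * g₂) = blowupNumberAux n P f g₁ + blowupNumberAux n P f g₂ := by
  induction n generalizing P f g₁ g₂ with
  | zero => simp [blowupNumberAux]
  | succ n ih =>
    by_cases hP : eval P f = 0
    swap
    · rw [blowupNumberAux_eq_zero (fun h => hP h.1), blowupNumberAux_eq_zero (fun h => hP h.1),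
        blowupNumberAux_eq_zero (fun h => hP h.1), add_zero]
    by_cases hs : ShareComponentThrough P f (g₁ * g₂)
    · rw [blowupNumberAux, if_pos hs]
      rcases shareComponentThrough_mul_iff.1 hs with h | h
      · rw [blowupNumberAux, if_pos h, top_add]
      · rw [add_comm, blowupNumberAux, if_pos h, top_add]
    · have hs' := hs
      rw [shareComponentThrough_mul_iff, not_or] at hs'
      have h1 := ne_zero_of_not_share (mt ShareComponentThrough.symm hs'.1) hP
      have h2 := ne_zero_of_not_share (mt ShareComponentThrough.symm hs'.2) hP
      by_cases hf : f = 0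
      · subst hf
        -- A polynomial vanishing at `P` would share a component through `P` with `0`.
        have e1 : eval P g₁ ≠ 0 := fun h => ne_zero_of_not_share hs'.1 h rfl
        have e2 : eval P g₂ ≠ 0 := fun h => ne_zero_of_not_share hs'.2 h rfl
        rw [blowupNumberAux_eq_zero, blowupNumberAux_eq_zero, blowupNumberAux_eq_zero, add_zero]
        all_goals simp [e1, e2]
      rw [blowupNumberAux_succ hf (mul_ne_zero h1 h2) hs, blowupNumberAux_succ hf h1 hs'.1,
        blowupNumberAux_succ hf h2 hs'.2,
        (mult_strictTransform_mul P h1 h2 OnePoint.infty).1]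
      simp only [(mult_strictTransform_mul P h1 h2 _).2, ih, Finset.sum_add_distrib]
      push_cast
      ring

theorem blowupNumber_mul (P : Fin 2 → k) (f g₁ g₂ : MvPolynomial (Fin 2) k) :
    blowupNumber P f (g₁ * g₂) = blowupNumber P f g₁ + blowupNumber P f g₂ := by
  unfold blowupNumber
  simp only [blowupNumberAux_mul]
  rw [ENat.iSup_add_iSup_of_monotone (blowupNumberAux_monotone _ _ _)
    (blowupNumberAux_monotone _ _ _)]

theorem blowupNumber_one (P : Fin 2 → k) (f : MvPolynomial (Fin 2) k) :
    blowupNumber P f 1 = 0 :=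
  blowupNumber_eq_zero (by simp)

theorem blowupNumber_pow (P : Fin 2 → k) (f g : MvPolynomial (Fin 2) k) (n : ℕ) :
    blowupNumber P f (g ^ n) = n * blowupNumber P f g := by
  induction n with
  | zero => simp [blowupNumber_one]
  | succ n ih =>
    rw [pow_succ, blowupNumber_mul, ih]
    push_cast
    ring

/-! ### Intersection with the exceptional line -/

theorem mult_strictTransform_X_zero_infty (c : k) :
    mult ![0, c] (X 0 : MvPolynomial (Fin 2) k) = 1 ∧
      strictTransform ![0, c] (X 0 : MvPolynomial (Fin 2) k) OnePoint.infty = X 0 := by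
  apply mult_and_strictTransform_eq (X_ne_zero 0)
  · simp [pullback, exceptional, mul_comm]
  · intro h
    have := map_dvd (restrictExc OnePoint.infty) h
    rw [restrictExc_exceptional, zero_dvd_iff] at this
    simp [restrictExc] at this

/-- The strict transform of the line `x = 0` meets the exceptional line only at `∞`, so every other
point contributes nothing. -/
theorem strictTransform_X_zero_coe (c a : k) :
    strictTransform ![0, c] (X 0 : MvPolynomial (Fin 2) k) (OnePoint.some a) = 1 :=
  (mult_and_strictTransform_eq (n := 1) (X_ne_zero 0) (by simp [pullback, exceptional])
    (prime_exceptional _).not_dvd_one).2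

theorem mult_strictTransform_X_one_coe (a : k) :
    mult ![0, 0] (X 1 : MvPolynomial (Fin 2) k) = 1 ∧
      strictTransform ![0, 0] (X 1 : MvPolynomial (Fin 2) k) (OnePoint.some a) = X 1 := by
  apply mult_and_strictTransform_eq (X_ne_zero 1)
  · simp [pullback, exceptional]
  · intro h
    have := map_dvd (restrictExc (OnePoint.some a)) h
    rw [restrictExc_exceptional, zero_dvd_iff] at this
    simp [restrictExc] at this

theorem strictTransform_X_one_infty :
    strictTransform ![0, 0] (X 1 : MvPolynomial (Fin 2) k) OnePoint.infty = 1 :=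
  (mult_and_strictTransform_eq (n := 1) (X_ne_zero 1) (by simp [pullback, exceptional])
    (prime_exceptional _).not_dvd_one).2

theorem not_share_exceptional {P : Fin 2 → k} {Q : OnePoint k} {f : MvPolynomial (Fin 2) k}
    (hf : restrictExc Q f ≠ 0) : ¬ ShareComponentThrough P f (exceptional Q) := by
  rintro ⟨q, h1, h2, h3, -⟩
  have h4 : exceptional Q ∣ f :=
    ((h1.associated_of_dvd (prime_exceptional Q).irreducible h3).symm.dvd).trans h2
  have h5 := map_dvd (restrictExc Q) h4
  rw [restrictExc_exceptional, zero_dvd_iff] at h5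
  exact hf h5

/-- The intersection number of a curve with the line `x = 0` is the order of vanishing of its
equation on that line. -/
theorem blowupNumber_X_zero (c : k) (f : MvPolynomial (Fin 2) k)
    (hf : restrictExc (OnePoint.some c) f ≠ 0) :
    blowupNumber ![0, c] f (X 0) = (restrictExc (OnePoint.some c) f).rootMultiplicity c := by
  classical
  -- Blowing up lowers the order of vanishing by the multiplicity of `f`. The new point is the
  -- origin of its chart, so `c` must be general.
  induction hn : (restrictExc (OnePoint.some c) f).rootMultiplicity c using Nat.strong_induction_on
    generalizing c f with
  | _ n ih =>
  have hf0 : f ≠ 0 := by rintro rfl; simp at hf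
  have hev : eval ![0, c] f = (restrictExc (OnePoint.some c) f).eval c :=
    eval_excPoint (OnePoint.some c) f
  rcases Nat.eq_zero_or_pos n with h0 | hpos
  · rw [h0, blowupNumber_eq_zero]
    · rfl
    · rintro ⟨h, -⟩
      rw [hev] at h
      have := (Polynomial.rootMultiplicity_pos hf).2 h
      omega
  · have hroot : eval ![0, c] f = 0 := by
      rw [hev]
      exact (Polynomial.rootMultiplicity_pos hf).1 (hn ▸ hpos)
    set m := mult ![0, c] f with hm
    have hmpos : 0 < m := by
      rw [Nat.pos_iff_ne_zero, hm, ne_eq, mult_eq_zero_iff _ hf0, not_not]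
      exact hroot
    set f' := strictTransform ![0, c] f OnePoint.infty with hf'
    -- In the chart at `∞` the strict transform of `x = 0` is `w = 0`, and there the pullback of `f`
    -- is `f(0, c + v)`. Thus `v ^ m * f'(0, v) = f(0, c + v)`.
    have hcomp : (restrictExc (OnePoint.some (0 : k))).comp (pullback ![0, c] OnePoint.infty) =
        (Polynomial.aeval (Polynomial.X + Polynomial.C c)).comp
          (restrictExc (OnePoint.some c)) := by
      ext i
      fin_cases i <;> simp [restrictExc, pullback]
    have hkey : Polynomial.X ^ m * restrictExc (OnePoint.some 0) f' =
        (restrictExc (OnePoint.some c) f).comp (Polynomial.X + Polynomial.C c) := by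
      change _ = Polynomial.aeval (Polynomial.X + Polynomial.C c) _
      have := DFunLike.congr_fun hcomp f
      simp only [AlgHom.comp_apply, pullback_eq, map_mul, map_pow] at this
      simpa [restrictExc, exceptional] using this
    have hne : Polynomial.X ^ m * restrictExc (OnePoint.some 0) f' ≠ 0 := by
      rw [hkey, ne_eq, Polynomial.comp_X_add_C_eq_zero_iff]
      exact hf
    have hmult : n = m + (restrictExc (OnePoint.some 0) f').rootMultiplicity 0 := by
      rw [← hn, Polynomial.rootMultiplicity_eq_rootMultiplicity, ← hkey,
        Polynomial.rootMultiplicity_mul hne]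
      congr 1
      have := Polynomial.rootMultiplicity_X_sub_C_pow (0 : k) m
      simpa using this
    rw [blowupNumber_eq_sum hf0 (X_ne_zero 0)
      (not_share_exceptional (Q := OnePoint.some c) hf), (mult_strictTransform_X_zero_infty c).1,
      Finset.sum_eq_single OnePoint.infty, (mult_strictTransform_X_zero_infty c).2]
    · have := ih _ (by omega) 0 f' (right_ne_zero_of_mul hne) rfl
      change _ + blowupNumber ![0, 0] f' (X 0) = _
      rw [this, hmult]
      push_cast
      ring
    · intro Q _ hQ
      induction Q using OnePoint.rec with
      | infty => exact absurd rfl hQ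
      | coe a => rw [strictTransform_X_zero_coe, blowupNumber_one]
    · intro h
      exact absurd (Finset.mem_insert_self _ _) h

/-- The intersection number of a curve with the line `y = 0` is the order of vanishing of its
equation on that line. -/
theorem blowupNumber_X_one (f : MvPolynomial (Fin 2) k)
    (hf : restrictExc OnePoint.infty f ≠ 0) :
    blowupNumber ![0, 0] f (X 1) = (restrictExc OnePoint.infty f).rootMultiplicity 0 := by
  classical
  induction hn : (restrictExc OnePoint.infty f).rootMultiplicity 0 using Nat.strong_induction_on
    generalizing f with
  | _ n ih =>
  have hf0 : f ≠ 0 := by rintro rfl; simp at hf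
  have hev : eval ![0, 0] f = (restrictExc OnePoint.infty f).eval 0 :=
    eval_excPoint OnePoint.infty f
  rcases Nat.eq_zero_or_pos n with h0 | hpos
  · rw [h0, blowupNumber_eq_zero]
    · rfl
    · rintro ⟨h, -⟩
      rw [hev] at h
      have := (Polynomial.rootMultiplicity_pos hf).2 h
      omega
  · have hroot : eval ![0, 0] f = 0 := by
      rw [hev]
      exact (Polynomial.rootMultiplicity_pos hf).1 (hn ▸ hpos)
    set m := mult ![0, 0] f with hm
    have hmpos : 0 < m := by
      rw [Nat.pos_iff_ne_zero, hm, ne_eq, mult_eq_zero_iff _ hf0, not_not]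
      exact hroot
    set f' := strictTransform ![0, 0] f (OnePoint.some 0) with hf'
    -- The strict transform of `y = 0` is `z = 0`, on which the pullback is `f(u, 0)`. Thus `u ^ m *
    -- f'(u, 0) = f(u, 0)`, and only the point `(1 : 0)` contributes.
    have hcomp : (restrictExc OnePoint.infty).comp (pullback ![0, 0] (OnePoint.some (0 : k))) =
        restrictExc OnePoint.infty := by
      ext i
      fin_cases i <;> simp [restrictExc, pullback]
    have hkey : Polynomial.X ^ m * restrictExc OnePoint.infty f' =
        restrictExc OnePoint.infty f := by
      have := DFunLike.congr_fun hcomp f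
      simp only [AlgHom.comp_apply, pullback_eq, map_mul, map_pow] at this
      simpa [restrictExc, exceptional] using this
    have hne : Polynomial.X ^ m * restrictExc OnePoint.infty f' ≠ 0 := by
      rw [hkey]
      exact hf
    have hmult : n = m + (restrictExc OnePoint.infty f').rootMultiplicity 0 := by
      rw [← hn, ← hkey, Polynomial.rootMultiplicity_mul hne]
      congr 1
      have := Polynomial.rootMultiplicity_X_sub_C_pow (0 : k) m
      simpa using this
    rw [blowupNumber_eq_sum hf0 (X_ne_zero 1)
      (not_share_exceptional (Q := OnePoint.infty) hf), (mult_strictTransform_X_one_coe (0 : k)).1,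
      Finset.sum_eq_single (OnePoint.some 0), (mult_strictTransform_X_one_coe 0).2]
    · have := ih _ (by omega) f' (right_ne_zero_of_mul hne) rfl
      change _ + blowupNumber ![0, 0] f' (X 1) = _
      rw [this, hmult]
      push_cast
      ring
    · intro Q _ hQ
      induction Q using OnePoint.rec with
      | infty => rw [strictTransform_X_one_infty, blowupNumber_one]
      | coe a =>
        rw [(mult_strictTransform_X_one_coe a).2]
        apply blowupNumber_eq_zero
        rintro ⟨-, h⟩
        apply hQ
        have ha : a = 0 := by simpa [excPoint] using h
        rw [ha]
    · intro h
      apply blowupNumber_eq_zero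
      rintro ⟨h', -⟩
      exact h (mem_nearPoints hf0 h')

theorem blowupNumber_exceptional (Q : OnePoint k) (f : MvPolynomial (Fin 2) k)
    (hf : restrictExc Q f ≠ 0) : blowupNumber (excPoint Q) f (exceptional Q) =
      (restrictExc Q f).rootMultiplicity (excCoord Q) := by
  induction Q using OnePoint.rec with
  | infty => exact blowupNumber_X_one f hf
  | coe c => exact blowupNumber_X_zero c f hf

/-! ### Total intersection of a strict transform with the exceptional line -/

theorem natTrailingDegree_reflect {p : Polynomial k} (hp : p ≠ 0) {m : ℕ} (h : p.natDegree ≤ m) :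
    (p.reflect m).natTrailingDegree = m - p.natDegree := by
  have h0 : p.reflect m ≠ 0 := by simpa [Polynomial.reflect_eq_zero_iff] using hp
  apply le_antisymm
  · apply Polynomial.natTrailingDegree_le_of_ne_zero
    rw [Polynomial.coeff_reflect, Polynomial.revAt_le (Nat.sub_le _ _), Nat.sub_sub_self h]
    simpa using hp
  · apply Polynomial.le_natTrailingDegree h0
    intro i hi
    rw [Polynomial.coeff_reflect, Polynomial.revAt_le (by omega)]
    exact Polynomial.coeff_eq_zero_of_natDegree_lt (by omega)

theorem natDegree_restrictExc_strictTransform_le (P : Fin 2 → k) (f : MvPolynomial (Fin 2) k)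
    (c : k) : (restrictExc (OnePoint.some c)
      (strictTransform P f (OnePoint.some c))).natDegree ≤ mult P f := by
  rw [Polynomial.natDegree_le_iff_coeff_eq_zero]
  intro j hj
  rw [coeff_restrictExc_strictTransform_some, if_neg (by omega)]

/-- Both sides dehomogenise the same form of degree `mult P f`, with respect to the two different
coordinates. -/
theorem restrictExc_strictTransform_infty (P : Fin 2 → k) (f : MvPolynomial (Fin 2) k) (c : k) :
    restrictExc OnePoint.infty (strictTransform P f OnePoint.infty) =
      (restrictExc (OnePoint.some c)
        (strictTransform P f (OnePoint.some c))).reflect (mult P f) := by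
  ext j
  rw [coeff_restrictExc_strictTransform_infty, Polynomial.coeff_reflect]
  split_ifs with h
  · rw [Polynomial.revAt_le h, coeff_restrictExc_strictTransform_some, if_pos (Nat.sub_le _ _),
      Nat.sub_sub_self h]
  · rw [Polynomial.revAt_eq_self_of_lt (by omega), coeff_restrictExc_strictTransform_some,
      if_neg h]

/-- The strict transform of `f` meets the exceptional line with total multiplicity `m_P(f)`. -/
theorem sum_blowupNumber_exceptional [IsAlgClosed k] (P : Fin 2 → k) {f : MvPolynomial (Fin 2) k}
    (hf : f ≠ 0) :
    ∑ Q ∈ nearPoints P f, blowupNumber (excPoint Q) (strictTransform P f Q) (exceptional Q) =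
      mult P f := by
  classical
  simp only [fun Q => blowupNumber_exceptional Q _ (restrictExc_strictTransform_ne_zero P hf Q)]
  rw [← Nat.cast_sum, nearPoints, Finset.sum_insert, Finset.sum_map]
  · congr 1
    set q := restrictExc (OnePoint.some 0) (strictTransform P f (OnePoint.some 0)) with hq
    have hq0 : q ≠ 0 := restrictExc_strictTransform_ne_zero P hf _
    have hqm : q.natDegree ≤ mult P f := natDegree_restrictExc_strictTransform_le P f 0
    -- The affine points account for the degree of `q`; the drop from `mult P f` to that degree is
    -- the order of vanishing at `∞`.
    have h1 : ∑ c ∈ q.roots.toFinset, q.rootMultiplicity c = q.natDegree := by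
      rw [(IsAlgClosed.splits q).natDegree_eq_card_roots, ← Multiset.toFinset_sum_count_eq]
      simp only [Polynomial.count_roots]
    have h2 : (restrictExc OnePoint.infty (strictTransform P f OnePoint.infty)).rootMultiplicity
        (excCoord OnePoint.infty) = mult P f - q.natDegree := by
      rw [restrictExc_strictTransform_infty P f 0, ← hq]
      exact Polynomial.rootMultiplicity_eq_natTrailingDegree'.trans
        (natTrailingDegree_reflect hq0 hqm)
    rw [h2]
    change _ + ∑ c ∈ q.roots.toFinset, q.rootMultiplicity c = _
    rw [h1]
    omega
  · intro h
    obtain ⟨c, -, hc⟩ := Finset.mem_map.1 h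
    exact OnePoint.coe_ne_infty c hc

/-! ### Invariance -/

/-- Each factor `e` restored to the second argument adds `mult P f` to the sum, which exactly pays
for lowering `mult P g` by one. -/
theorem blowupNumber_eq_sum_of_le_mult [IsAlgClosed k] {P : Fin 2 → k}
    {f g : MvPolynomial (Fin 2) k} (hf : f ≠ 0) (hg : g ≠ 0)
    (hs : ¬ ShareComponentThrough P f g) {m : ℕ} (hm : m ≤ mult P g) :
    blowupNumber P f g = (mult P f : ℕ∞) * (m : ℕ∞) +
      ∑ Q ∈ nearPoints P f, blowupNumber (excPoint Q) (strictTransform P f Q)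
        (exceptional Q ^ (mult P g - m) * strictTransform P g Q) := by
  simp only [blowupNumber_mul, blowupNumber_pow, Finset.sum_add_distrib]
  rw [← Finset.mul_sum, sum_blowupNumber_exceptional P hf, blowupNumber_eq_sum hf hg hs]
  obtain ⟨d, hd⟩ := Nat.exists_eq_add_of_le hm
  rw [hd, Nat.add_sub_cancel_left]
  push_cast
  ring

/-- The strict transforms of `f`, `g` and `g + h f`, up to powers of the equation of the
exceptional line, are related in the same way as `f`, `g` and `g + h f`. -/
theorem exists_strictTransform_add_mul (P : Fin 2 → k) {f g h : MvPolynomial (Fin 2) k}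
    (hf : f ≠ 0) {m : ℕ} (hm : m ≤ mult P g) (hm' : m ≤ mult P (g + h * f)) (Q : OnePoint k) :
    ∃ h', exceptional Q ^ (mult P (g + h * f) - m) * strictTransform P (g + h * f) Q =
      exceptional Q ^ (mult P g - m) * strictTransform P g Q + h' * strictTransform P f Q := by
  have he := prime_exceptional Q
  have hpow : ∀ p, m ≤ mult P p → pullback P Q p =
      exceptional Q ^ m * (exceptional Q ^ (mult P p - m) * strictTransform P p Q) := by
    intro p hp
    rw [pullback_eq, ← mul_assoc, ← pow_add, Nat.add_sub_cancel' hp]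
  have h1 : pullback P Q (g + h * f) = pullback P Q g +
      pullback P Q h * exceptional Q ^ mult P f * strictTransform P f Q := by
    rw [map_add, map_mul, pullback_eq P Q f, mul_assoc]
  rw [hpow _ hm, hpow _ hm'] at h1
  -- `e ^ m` divides the difference of the two pullbacks. As `e` does not divide the strict
  -- transform of `f`, all of `e ^ m` divides the other factor, whether or not `m ≤ mult P f`; the
  -- quotient is `h'`.
  obtain ⟨h', hh'⟩ := he.pow_dvd_of_dvd_mul_right m
    (not_exceptional_dvd_strictTransform P hf Q)
    ((dvd_add_right (dvd_mul_right _ _)).1 (h1 ▸ dvd_mul_right (exceptional Q ^ m) _))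
  refine ⟨h', mul_left_cancel₀ (pow_ne_zero m he.ne_zero) ?_⟩
  rw [h1, hh']
  ring

/-- The induction is on the value itself, so it needs finiteness for `g` only; finiteness for `g + h
* f` is part of the conclusion. -/
theorem blowupNumber_add_mul_of_eq_natCast [IsAlgClosed k] (N : ℕ) (P : Fin 2 → k)
    (f g h : MvPolynomial (Fin 2) k) (hN : blowupNumber P f g = N) :
    blowupNumber P f (g + h * f) = N := by
  induction N using Nat.strong_induction_on generalizing P f g h with
  | _ N ih =>
  have hs : ¬ ShareComponentThrough P f g := fun hs => by
    rw [blowupNumber_eq_top hs] at hN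
    exact ENat.top_ne_natCast N hN
  by_cases hP : eval P f = 0 ∧ eval P g = 0
  swap
  · rw [← hN, blowupNumber_eq_zero hP, blowupNumber_eq_zero]
    rintro ⟨h1, h2⟩
    exact hP ⟨h1, by simpa [h1] using h2⟩
  have hP' : eval P (g + h * f) = 0 := by simp [hP.1, hP.2]
  have hs' : ¬ ShareComponentThrough P f (g + h * f) := fun hs' => hs (by
    simpa using hs'.add_mul (-h))
  have hf := ne_zero_of_not_share hs hP.2
  have hg := ne_zero_of_not_share (mt ShareComponentThrough.symm hs) hP.1
  have hg' := ne_zero_of_not_share (mt ShareComponentThrough.symm hs') hP.1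
  have hpos : ∀ p : MvPolynomial (Fin 2) k, p ≠ 0 → eval P p = 0 → 0 < mult P p := by
    intro p hp h0
    rw [Nat.pos_iff_ne_zero, ne_eq, mult_eq_zero_iff _ hp, not_not]
    exact h0
  obtain ⟨m, hmpos, hmg, hmg'⟩ : ∃ m, 0 < mult P f * m ∧ m ≤ mult P g ∧
      m ≤ mult P (g + h * f) :=
    ⟨min (mult P g) (mult P (g + h * f)),
      Nat.mul_pos (hpos f hf hP.1) (lt_min (hpos g hg hP.2) (hpos _ hg' hP')),
      min_le_left _ _, min_le_right _ _⟩
  rw [blowupNumber_eq_sum_of_le_mult hf hg hs hmg] at hN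
  rw [blowupNumber_eq_sum_of_le_mult hf hg' hs' hmg', ← hN]
  refine congrArg₂ (· + ·) rfl (Finset.sum_congr rfl fun Q hQ => ?_)
  obtain ⟨h', hh'⟩ := exists_strictTransform_add_mul P hf hmg hmg' Q
  rw [hh']
  -- One term `M` of the sum satisfies `mult P f * m + M ≤ N`. The first summand is positive, so `M
  -- < N`.
  have hle := add_le_add_right (Finset.single_le_sum
    (f := fun Q => blowupNumber (excPoint Q) (strictTransform P f Q)
      (exceptional Q ^ (mult P g - m) * strictTransform P g Q))
    (fun _ _ => zero_le) hQ) ((mult P f : ℕ∞) * (m : ℕ∞))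
  rw [hN] at hle
  obtain ⟨M, hM⟩ := ENat.ne_top_iff_exists.1
    (ne_top_of_le_ne_top (ENat.natCast_ne_top N) (le_add_self.trans hle))
  rw [← hM] at hle
  have hle' : mult P f * m + M ≤ N := by exact_mod_cast hle
  rw [ih M (by omega) _ _ _ h' hM.symm]
  exact hM

/-- Since `g = (g + h * f) + (-h) * f`, finiteness on either side gives it on the other, which
settles the case of the value `⊤`. -/
theorem blowupNumber_add_mul [IsAlgClosed k] (P : Fin 2 → k) (f g h : MvPolynomial (Fin 2) k) :
    blowupNumber P f (g + h * f) = blowupNumber P f g := by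
  by_cases h1 : blowupNumber P f g = ⊤
  · by_cases h2 : blowupNumber P f (g + h * f) = ⊤
    · rw [h1, h2]
    · obtain ⟨N, hN⟩ := ENat.ne_top_iff_exists.1 h2
      have := blowupNumber_add_mul_of_eq_natCast N P f _ (-h) hN.symm
      rw [neg_mul, add_neg_cancel_right] at this
      rw [this, hN]
  · obtain ⟨N, hN⟩ := ENat.ne_top_iff_exists.1 h1
    rw [← hN]
    exact blowupNumber_add_mul_of_eq_natCast N P f g h hN.symm

end PlaneCurve

end

theorem proposition3p8 {k : Type*} [Field k] [IsAlgClosed k] [CharZero k]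
    (P : Fin 2 → k) (f g : MvPolynomial (Fin 2) k)
    (hf : 0 < f.totalDegree) (hg : 0 < g.totalDegree)
    (hfg : ¬ PlaneCurve.ShareComponentThrough P f g) (h : MvPolynomial (Fin 2) k) :
    PlaneCurve.blowupNumber P f (g + h * f) = PlaneCurve.blowupNumber P f g := by
  exact PlaneCurve.blowupNumber_add_mul P f g h
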